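/- Let $P(z)=\sum_{j=0}^{n}a_jz^j$ be a polynomial of degree $n$ with complex coefficients, and let $\rho\ge 1$ be a real number such that $P(z)\neq 0$ for all complex $z$ with $|z|<\rho$. Put $\|P\|_\infty=\max_{|z|=1}|P(z)|$. Then, for every $s=1,\dots,n-1$, $$|a_n|+\frac{|a_s|}{\binom{n}{s}}\le\frac{\|P\|_\infty}{1+\rho^s}.$$ -/

import Mathlib

/-- The norm `‖P‖_∞ = max_{|z| = 1} |P(z)|` of a complex polynomial. -/
noncomputable def circleSupNorm (P : Polynomial ℂ) : ℝ :=
  sSup ((fun z : ℂ => ‖P.eval z‖) '' Metric.sphere (0 : ℂ) 1)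

/-- The supremum in `circleSupNorm` is a maximum: it is attained on the unit circle. -/
theorem circleSupNorm_isGreatest (P : Polynomial ℂ) :
    IsGreatest ((fun z : ℂ => ‖P.eval z‖) '' Metric.sphere (0 : ℂ) 1) (circleSupNorm P) := by
  have hc : IsCompact ((fun z : ℂ => ‖P.eval z‖) '' Metric.sphere (0 : ℂ) 1) :=
    (isCompact_sphere (0 : ℂ) 1).image P.continuous.norm
  exact hc.isGreatest_sSup ⟨_, Set.mem_image_of_mem _ (x := (1 : ℂ)) (by simp)⟩

/-!
Let `P(x, y)` be the homogenization in degree `n` of a polynomial `p` without zeros in `‖z‖ < ρ`.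
For `z` and `t` in that disc, `(z + t τ, 1 + τ)` stays in the cone `‖x‖ < ρ ‖y‖`, where `P` does not
vanish, as long as `τ` stays in a certain closed half-plane with `0` on its boundary
(`Polynomial.eval_polarPencil_ne_zero`). By Gauss-Lucas the coefficients of `P(z + t τ, 1 + τ)` in
`τ` are then nonzero. The `s`-th one is a polynomial in `t` of degree at most `s`, with extreme
coefficients `∂_y ^ s P / s!` and `∂_x ^ s P / s!` at `(z, 1)`, and it has no zeros in `‖t‖ < ρ`.
The product of its roots therefore yields `ρ ^ s ‖∂_x ^ s P‖ ≤ ‖∂_y ^ s P‖`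
(`Polynomial.mixedDeriv_zero_ne_zero_and_pow_mul_norm_le`).

Applied with `ρ = 1` to `p - c M`, where `M` is the maximum of `‖p‖` on the unit circle and
`1 < ‖c‖`, the same comparison gives `‖∂_x ^ s P‖ + ‖∂_y ^ s P‖ ≤ s! (n.choose s) M` in the unit
disc (`Polynomial.norm_mixedDeriv_add_le`). The two estimates together bound the `s`-th Hasse
derivative of `p` by `(n.choose s) M / (1 + ρ ^ s)` on the closed unit disc, and Visser's inequality
(`Polynomial.norm_coeff_zero_add_norm_coeff_le`) for that derivative, whose extreme coefficients
are `a_s` and `(n.choose s) a_n`, is the claim.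
-/

/-! ### Coefficients and the location of zeros -/

open Polynomial in
/-- If all zeros of `p` lie in the open half-plane `Re (β z) < 0`, then no coefficient of `p` up to its
degree vanishes: by the Gauss-Lucas theorem the same holds for every nonzero derivative of `p`, so
that none of these vanishes at `0`. -/
theorem Polynomial.coeff_ne_zero_of_forall_halfPlane_eval_ne_zero (β : ℂ) (k : ℕ) (p : ℂ[X])
    (hp : ∀ z : ℂ, 0 ≤ (β * z).re → p.eval z ≠ 0) (hk : k ≤ p.natDegree) : p.coeff k ≠ 0 := by
  induction k generalizing p with
  | zero =>
    rw [coeff_zero_eq_eval_zero]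
    exact hp 0 (by simp)
  | succ k ih =>
    have hd : derivative p ≠ 0 := fun h => by
      have := derivative_eq_zero.mp h
      omega
    have hroot : ∀ z : ℂ, 0 ≤ (β * z).re → (derivative p).eval z ≠ 0 := by
      intro z hz h0
      have hmem : z ∈ convexHull ℝ (p.rootSet ℂ) :=
        rootSet_derivative_subset_convexHull_rootSet (natDegree_pos_iff_degree_pos.mp (by omega))
          (by rw [mem_rootSet]; exact ⟨hd, by simpa using h0⟩)
      have hconv : Convex ℝ {w : ℂ | (β * w).re < 0} :=
        convex_halfSpace_lt
          ⟨fun x y => by simp [mul_add], fun c x => by simp; ring⟩ 0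
      have hlt := convexHull_min (s := p.rootSet ℂ) (fun w hw => by
        by_contra hneg
        exact hp w (not_lt.mp hneg) (by simpa using (mem_rootSet.mp hw).2)) hconv hmem
      exact absurd hz (not_le.mpr hlt)
    have hne := ih (derivative p) hroot (by rw [natDegree_derivative]; omega)
    rw [coeff_derivative] at hne
    exact left_ne_zero_of_mul hne

open Polynomial in
/-- If `p` has formal degree `k` and no zeros in `‖z‖ < ρ`, comparing its extreme coefficients through
the product of the roots gives `ρ ^ k * ‖p.coeff k‖ ≤ ‖p.coeff 0‖`. -/
theorem Polynomial.pow_mul_norm_coeff_le_of_forall_ball_eval_ne_zero {ρ : ℝ} (hρ : 0 < ρ) {k : ℕ}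
    {p : ℂ[X]} (hk : p.natDegree ≤ k) (hp : ∀ z : ℂ, ‖z‖ < ρ → p.eval z ≠ 0) :
    ρ ^ k * ‖p.coeff k‖ ≤ ‖p.coeff 0‖ := by
  rcases hk.lt_or_eq with hlt | rfl
  · simp [coeff_eq_zero_of_natDegree_lt hlt]
  have hroots : ∀ m : Multiset ℂ, (∀ w ∈ m, ρ ≤ ‖w‖) → ρ ^ m.card ≤ ‖m.prod‖ := by
    intro m
    induction m using Multiset.induction_on with
    | empty => simp
    | cons a m ih =>
      intro h
      rw [Multiset.card_cons, pow_succ', Multiset.prod_cons, norm_mul]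
      exact mul_le_mul (h a (by simp)) (ih fun w hw => h w (by simp [hw])) (by positivity)
        (norm_nonneg _)
  have hs := IsAlgClosed.splits p
  rw [hs.coeff_zero_eq_leadingCoeff_mul_prod_roots, hs.natDegree_eq_card_roots, norm_mul, norm_mul,
    ← hs.natDegree_eq_card_roots, coeff_natDegree]
  simp only [norm_pow, norm_neg, norm_one, one_pow, one_mul]
  rw [mul_comm, hs.natDegree_eq_card_roots]
  gcongr
  refine hroots _ fun w hw => ?_
  by_contra hneg
  exact hp w (not_le.mp hneg) (isRoot_of_mem_roots hw)

/-! ### Mixed partial derivatives of the homogenization -/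

open Polynomial in
/-- The polynomial `P(z + t τ, 1 + τ) = ∑ j, a_j (z + t τ) ^ j (1 + τ) ^ (n - j)` in `τ`, where
`P(x, y) = ∑ j, a_j x ^ j y ^ (n - j)` is the homogenization of `p` in formal degree `n`. Its
`k`-th coefficient is `(t ∂_x + ∂_y) ^ k P / k!` at `(z, 1)`. The factor `(t X + z) ^ j` is written
as a composition so that its coefficients are those of `(X + C z) ^ j` times powers of `t`. -/
noncomputable def Polynomial.polarPencil (n : ℕ) (p : ℂ[X]) (z t : ℂ) : ℂ[X] :=
  ∑ j ∈ Finset.range (n + 1), C (p.coeff j) * ((X + C z) ^ j).comp (C t * X) * (1 + X) ^ (n - j)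

open Polynomial in
/-- The value at `(z, 1)` of `∂_x ^ i ∂_y ^ (k - i) P / (i! (k - i)!)`, for `i ≤ k`, where
`P(x, y) = ∑ j, a_j x ^ j y ^ (n - j)` is the homogenization of `p` in formal degree `n`. The
truncated exponent `j - i` is harmless, since `j.choose i` vanishes for `j < i`. -/
noncomputable def Polynomial.mixedDeriv (n k i : ℕ) (p : ℂ[X]) (z : ℂ) : ℂ :=
  ∑ j ∈ Finset.range (n + 1), p.coeff j * (z ^ (j - i) * j.choose i * (n - j).choose (k - i))

open Polynomial in
theorem Polynomial.coeff_polarPencil (n k : ℕ) (p : ℂ[X]) (z t : ℂ) :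
    (polarPencil n p z t).coeff k
      = ∑ i ∈ Finset.range (k + 1), mixedDeriv n k i p z * t ^ i := by
  simp only [polarPencil, mixedDeriv, finsetSum_coeff, mul_assoc, coeff_C_mul, Finset.sum_mul]
  rw [Finset.sum_comm]
  refine Finset.sum_congr rfl fun j _ => ?_
  rw [coeff_mul, Finset.Nat.sum_antidiagonal_eq_sum_range_succ_mk, Finset.mul_sum]
  refine Finset.sum_congr rfl fun i _ => ?_
  simp only [comp_C_mul_X_coeff, coeff_X_add_C_pow, coeff_one_add_X_pow]
  ring

open Polynomial in
/-- The leading coefficient of `P(z + t τ, 1 + τ)` in `τ` is `P(t, 1) = p(t)`. -/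
theorem Polynomial.coeff_polarPencil_self {n : ℕ} {p : ℂ[X]} (hn : p.natDegree ≤ n) (z t : ℂ) :
    (polarPencil n p z t).coeff n = p.eval t := by
  rw [eval_eq_sum_range' (Nat.lt_succ_of_le hn)]
  simp only [polarPencil, finsetSum_coeff, mul_assoc, coeff_C_mul]
  refine Finset.sum_congr rfl fun j hj => ?_
  have hj : j ≤ n := Nat.lt_succ_iff.mp (Finset.mem_range.mp hj)
  have h1 : (((X + C z) ^ j).comp (C t * X)).natDegree ≤ j := by
    refine natDegree_comp_le.trans ?_
    have ha : ((X + C z) ^ j).natDegree ≤ j := by simp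
    have hb : (C t * X).natDegree ≤ 1 := (natDegree_C_mul_le _ _).trans natDegree_X_le
    simpa using Nat.mul_le_mul ha hb
  have h2 : ((1 + X : ℂ[X]) ^ (n - j)).natDegree ≤ n - j := by
    rw [← C_1, add_comm, natDegree_pow, natDegree_X_add_C, mul_one]
  have := coeff_mul_add_eq_of_natDegree_le h1 h2
  rw [Nat.add_sub_cancel' hj] at this
  rw [this, comp_C_mul_X_coeff, coeff_X_add_C_pow, coeff_one_add_X_pow]
  simp

open Polynomial in
theorem Polynomial.eval_polarPencil {n : ℕ} {p : ℂ[X]} (hn : p.natDegree ≤ n) (z t : ℂ) {τ : ℂ}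
    (hτ : 1 + τ ≠ 0) :
    (polarPencil n p z t).eval τ = (1 + τ) ^ n * p.eval ((z + t * τ) / (1 + τ)) := by
  rw [eval_eq_sum_range' (Nat.lt_succ_of_le hn), Finset.mul_sum]
  simp only [polarPencil, eval_finsetSum]
  refine Finset.sum_congr rfl fun j hj => ?_
  have hj : j ≤ n := Nat.lt_succ_iff.mp (Finset.mem_range.mp hj)
  simp only [eval_mul, eval_C, eval_comp, eval_pow, eval_add, eval_X, eval_one]
  rw [div_pow, ← Nat.sub_add_cancel hj, pow_add, Nat.add_sub_cancel]
  field_simp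
  ring

/-! ### Polynomials without zeros in a disc -/

open Polynomial ComplexConjugate in
/-- A form without zeros in the cone `‖x‖ < ρ ‖y‖` does not vanish at `(z + t τ, 1 + τ)` for `τ` in a
closed half-plane, because the point lies in the cone there:
`ρ² ‖1 + τ‖² - ‖z + t τ‖² = (ρ² - ‖z‖²) + (ρ² - ‖t‖²) ‖τ‖² + 2 Re ((ρ² - z̄ t) τ)`. -/
theorem Polynomial.eval_polarPencil_ne_zero {n : ℕ} {p : ℂ[X]} (hn : p.natDegree ≤ n) {ρ : ℝ}
    (hp : ∀ z : ℂ, ‖z‖ < ρ → p.eval z ≠ 0) {z t τ : ℂ} (hz : ‖z‖ < ρ) (ht : ‖t‖ < ρ)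
    (hτ : 0 ≤ (((ρ : ℂ) ^ 2 - conj z * t) * τ).re) : (polarPencil n p z t).eval τ ≠ 0 := by
  have hz2 : z.re ^ 2 + z.im ^ 2 < ρ ^ 2 := by
    have := pow_lt_pow_left₀ hz (norm_nonneg z) two_ne_zero
    rwa [Complex.sq_norm, Complex.normSq_apply, ← sq, ← sq] at this
  have ht2 : t.re ^ 2 + t.im ^ 2 < ρ ^ 2 := by
    have := pow_lt_pow_left₀ ht (norm_nonneg t) two_ne_zero
    rwa [Complex.sq_norm, Complex.normSq_apply, ← sq, ← sq] at this
  have key : ‖z + t * τ‖ ^ 2 < (ρ * ‖1 + τ‖) ^ 2 := by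
    rw [mul_pow, Complex.sq_norm, Complex.sq_norm, Complex.normSq_apply, Complex.normSq_apply]
    simp [sq] at hτ ⊢
    -- The displayed identity, with its middle term supplied as a hint.
    nlinarith [mul_nonneg (sub_nonneg.mpr ht2.le) (add_nonneg (sq_nonneg τ.re) (sq_nonneg τ.im))]
  have hρ : 0 < ρ := (norm_nonneg z).trans_lt hz
  have key' : ‖z + t * τ‖ < ρ * ‖1 + τ‖ := lt_of_pow_lt_pow_left₀ 2 (by positivity) key
  have h1 : 0 < ‖1 + τ‖ := pos_of_mul_pos_right ((norm_nonneg _).trans_lt key') hρ.le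
  have h1' : 1 + τ ≠ 0 := norm_pos_iff.mp h1
  rw [eval_polarPencil hn z t h1']
  refine mul_ne_zero (pow_ne_zero _ h1') (hp _ ?_)
  rwa [norm_div, div_lt_iff₀ h1]

open Polynomial ComplexConjugate in
/-- If `p` has no zeros in `‖z‖ < ρ`, then in that disc the `y`-derivative of order `k` of its
homogenization does not vanish and dominates `ρ ^ k` times the `x`-derivative of order `k`. -/
theorem Polynomial.mixedDeriv_zero_ne_zero_and_pow_mul_norm_le {n k : ℕ} {p : ℂ[X]}
    (hn : p.natDegree ≤ n) (hk : k ≤ n) {ρ : ℝ} (hp : ∀ z : ℂ, ‖z‖ < ρ → p.eval z ≠ 0) {z : ℂ}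
    (hz : ‖z‖ < ρ) :
    mixedDeriv n k 0 p z ≠ 0 ∧
      ρ ^ k * ‖mixedDeriv n k k p z‖ ≤ ‖mixedDeriv n k 0 p z‖ := by
  have hρ : 0 < ρ := (norm_nonneg z).trans_lt hz
  -- The `k`-th coefficient of `polarPencil n p z t`, as a polynomial in `t`.
  set h : ℂ[X] := ∑ i ∈ Finset.range (k + 1), C (mixedDeriv n k i p z) * X ^ i with hh
  have hcoeff : ∀ i ≤ k, h.coeff i = mixedDeriv n k i p z := by
    intro i hi
    simp [hh, coeff_C_mul, coeff_X_pow, Nat.lt_succ_of_le hi]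
  have hdeg : h.natDegree ≤ k := natDegree_sum_le_of_forall_le _ _ fun i hi =>
    (natDegree_C_mul_X_pow_le _ _).trans (Nat.lt_succ_iff.mp (Finset.mem_range.mp hi))
  have hne : ∀ t : ℂ, ‖t‖ < ρ → h.eval t ≠ 0 := by
    intro t ht
    have : h.eval t = (polarPencil n p z t).coeff k := by
      simp [coeff_polarPencil, hh, eval_finsetSum]
    rw [this]
    refine coeff_ne_zero_of_forall_halfPlane_eval_ne_zero ((ρ : ℂ) ^ 2 - conj z * t) k _
      (fun τ hτ => eval_polarPencil_ne_zero hn hp hz ht hτ) (hk.trans (le_natDegree_of_ne_zero ?_))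
    rw [coeff_polarPencil_self hn]
    exact hp t ht
  rw [← hcoeff 0 (Nat.zero_le k), ← hcoeff k le_rfl]
  refine ⟨?_, pow_mul_norm_coeff_le_of_forall_ball_eval_ne_zero hρ hdeg hne⟩
  rw [coeff_zero_eq_eval_zero]
  exact hne 0 (by simpa using hρ)

open Polynomial in
theorem Polynomial.mixedDeriv_self {n : ℕ} {p : ℂ[X]} (hn : p.natDegree ≤ n) (k : ℕ) (z : ℂ) :
    mixedDeriv n k k p z = (hasseDeriv k p).eval z := by
  rw [hasseDeriv_apply, sum_over_range' p (by simp) (n + 1) (Nat.lt_succ_of_le hn)]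
  simp only [mixedDeriv, eval_finsetSum, eval_monomial]
  refine Finset.sum_congr rfl fun j _ => ?_
  simp
  ring

open Polynomial in
/-- Subtracting a constant `c` from `p` subtracts `c y ^ n` from its homogenization. -/
theorem Polynomial.mixedDeriv_sub_C (n k i : ℕ) (p : ℂ[X]) (c z : ℂ) :
    mixedDeriv n k i (p - C c) z
      = mixedDeriv n k i p z - c * ((0 : ℕ).choose i * n.choose (k - i)) := by
  simp only [mixedDeriv]
  simp only [coeff_sub, sub_mul, Finset.sum_sub_distrib]
  congr 1
  rw [Finset.sum_eq_single 0]
  · simp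
  · intro j _ hj
    simp [coeff_C, hj]
  · simp

/-! ### Bounds in terms of the maximum on the unit circle -/

open Polynomial in
/-- A polynomial is bounded on the closed unit disc by its maximum on the unit circle. -/
theorem norm_eval_le_circleSupNorm (P : ℂ[X]) {z : ℂ} (hz : ‖z‖ ≤ 1) :
    ‖P.eval z‖ ≤ circleSupNorm P := by
  refine Complex.norm_le_of_forall_mem_frontier_norm_le (U := Metric.ball (0 : ℂ) 1)
    Metric.isBounded_ball P.differentiable.diffContOnCl (fun w hw => ?_) ?_
  · rw [frontier_ball _ one_ne_zero] at hw
    exact (circleSupNorm_isGreatest P).2 (Set.mem_image_of_mem _ hw)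
  · rw [closure_ball _ one_ne_zero]
    simpa using hz

open Polynomial in
/-- A polynomial bounded by `M` on the open unit disc satisfies a sharpened Bernstein inequality there:
the `x`- and `y`-derivatives of order `k` of its homogenization, divided by `k!`, have absolute values
adding up to at most `n.choose k * M`. The polynomials `p - c M` with `1 < ‖c‖` have no zeros in
the disc, so that the comparison of the two derivatives applies to them. -/
theorem Polynomial.norm_mixedDeriv_add_le {n k : ℕ} {p : ℂ[X]}
    (hn : p.natDegree ≤ n) (hk₀ : k ≠ 0) (hk : k ≤ n) {M : ℝ} (hM : 0 < M)
    (hp : ∀ z : ℂ, ‖z‖ < 1 → ‖p.eval z‖ ≤ M) {z : ℂ} (hz : ‖z‖ < 1) :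
    ‖mixedDeriv n k 0 p z‖ + ‖mixedDeriv n k k p z‖ ≤ n.choose k * M := by
  set a := mixedDeriv n k 0 p z with ha
  set b := mixedDeriv n k k p z with hb
  set K : ℝ := n.choose k * M with hK
  have hchoose : 0 < (n.choose k : ℝ) := by exact_mod_cast Nat.choose_pos hk
  have hK0 : 0 < K := by positivity
  have key : ∀ c : ℂ, 1 < ‖c‖ → a - c * K ≠ 0 ∧ ‖b‖ ≤ ‖a - c * K‖ := by
    intro c hc
    have hzero : ∀ w : ℂ, ‖w‖ < 1 → (p - C (c * M)).eval w ≠ 0 := by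
      intro w hw h0
      rw [eval_sub, eval_C, sub_eq_zero] at h0
      have h1 := hp w hw
      rw [h0, norm_mul, Complex.norm_real, Real.norm_of_nonneg hM.le] at h1
      nlinarith
    have hdeg : (p - C (c * M)).natDegree ≤ n := by
      rw [natDegree_sub_C]; exact hn
    have h := mixedDeriv_zero_ne_zero_and_pow_mul_norm_le hdeg hk hzero hz
    rw [mixedDeriv_sub_C, mixedDeriv_sub_C, Nat.choose_eq_zero_of_lt (Nat.pos_of_ne_zero hk₀)] at h
    have e : c * K = c * M * (((0 : ℕ).choose 0 : ℂ) * (n.choose (k - 0) : ℂ)) := by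
      rw [hK]; push_cast; simp; ring
    rw [e]
    simpa using h
  -- Otherwise `c = a / K` would be admissible, and make `a - c * K` vanish.
  have haK : ‖a‖ ≤ K := by
    by_contra hlt
    have hKc : (K : ℂ) ≠ 0 := by exact_mod_cast hK0.ne'
    refine (key (a / K) ?_).1 (by field_simp; simp)
    rw [norm_div, Complex.norm_real, Real.norm_of_nonneg hK0.le, one_lt_div hK0]
    exact not_le.mp hlt
  -- Choosing `c` of modulus `r` with the argument of `a` makes `‖a - c * K‖` equal to `r * K - ‖a‖`.
  have hr : ∀ r : ℝ, 1 < r → ‖a‖ + ‖b‖ ≤ r * K := by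
    intro r hr
    have h := (key (r * Complex.exp (a.arg * Complex.I))
      (by rw [norm_mul, Complex.norm_exp_ofReal_mul_I, Complex.norm_real, mul_one]
          exact hr.trans_le (le_abs_self r))).2
    have e : a - r * Complex.exp (a.arg * Complex.I) * K
        = ((‖a‖ - r * K : ℝ) : ℂ) * Complex.exp (a.arg * Complex.I) := by
      push_cast
      linear_combination -Complex.norm_mul_exp_arg_mul_I a
    rw [e, norm_mul, Complex.norm_exp_ofReal_mul_I, Complex.norm_real, mul_one, Real.norm_eq_abs,
      abs_of_nonpos (by nlinarith)] at h
    linarith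
  have hlim : Filter.Tendsto (fun r : ℝ => r * K) (nhdsWithin 1 (Set.Ioi 1)) (nhds (1 * K)) :=
    ((continuous_id.mul continuous_const).tendsto 1).mono_left nhdsWithin_le_nhds
  have := ge_of_tendsto hlim (Filter.eventually_of_mem self_mem_nhdsWithin hr)
  rwa [one_mul] at this

/-- Two complex numbers can be aligned by rotating the second one. -/
theorem exists_norm_add_exp_mul (a b : ℂ) :
    ∃ θ : ℝ, ‖a + Complex.exp (θ * Complex.I) * b‖ = ‖a‖ + ‖b‖ := by
  refine ⟨a.arg - b.arg, ?_⟩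
  have e : a + Complex.exp ((a.arg - b.arg : ℝ) * Complex.I) * b
      = ((‖a‖ + ‖b‖ : ℝ) : ℂ) * Complex.exp (a.arg * Complex.I) := by
    have : Complex.exp ((a.arg - b.arg : ℝ) * Complex.I) * Complex.exp (b.arg * Complex.I)
        = Complex.exp (a.arg * Complex.I) := by
      rw [← Complex.exp_add]; congr 1; push_cast; ring
    rw [Complex.ofReal_add]
    linear_combination (‖b‖ : ℂ) * this - Complex.norm_mul_exp_arg_mul_I a -
      Complex.exp ((a.arg - b.arg : ℝ) * Complex.I) * Complex.norm_mul_exp_arg_mul_I b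
  rw [e, norm_mul, Complex.norm_exp_ofReal_mul_I, Complex.norm_real, mul_one,
    Real.norm_of_nonneg (by positivity)]

open Polynomial in
/-- Visser's inequality: the extreme coefficients of a polynomial of formal degree `m` have absolute
values adding up to at most its maximum on the unit circle. Averaging `p` over the points `ω ^ k * ζ`,
with `ω` a primitive `m`-th root of unity, leaves `p.coeff 0 + ζ ^ m * p.coeff m`, and `ζ` is chosen
to align the two terms. -/
theorem Polynomial.norm_coeff_zero_add_norm_coeff_le {m : ℕ} (hm : m ≠ 0) {p : ℂ[X]}
    (hdeg : p.natDegree ≤ m) {K : ℝ} (hp : ∀ z : ℂ, ‖z‖ = 1 → ‖p.eval z‖ ≤ K) :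
    ‖p.coeff 0‖ + ‖p.coeff m‖ ≤ K := by
  obtain ⟨θ, hθ⟩ := exists_norm_add_exp_mul (p.coeff 0) (p.coeff m)
  have hmc : (m : ℂ) ≠ 0 := by exact_mod_cast hm
  set ζ : ℂ := Complex.exp ((θ / m : ℝ) * Complex.I) with hζ
  have hζm : ζ ^ m = Complex.exp (θ * Complex.I) := by
    rw [hζ, ← Complex.exp_nat_mul]; congr 1; push_cast; field_simp
  obtain ⟨ω, hω⟩ : ∃ ω : ℂ, IsPrimitiveRoot ω m := ⟨_, Complex.isPrimitiveRoot_exp m hm⟩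
  have hsum : ∑ k ∈ Finset.range m, p.eval (ω ^ k * ζ) = m * (p.coeff 0 + ζ ^ m * p.coeff m) := by
    simp only [eval_eq_sum_range' (Nat.lt_succ_of_le hdeg)]
    rw [Finset.sum_comm, Finset.sum_range_succ, Finset.sum_eq_single 0]
    · have : ∀ k, (ω ^ k * ζ) ^ m = ζ ^ m := fun k => by
        rw [mul_pow, ← pow_mul, mul_comm k m, pow_mul, hω.pow_eq_one, one_pow, one_mul]
      simp [this]
      ring
    · intro j hj hj0
      have hne : ω ^ j ≠ 1 := hω.pow_ne_one_of_pos_of_lt hj0 (Finset.mem_range.mp hj)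
      have : ∀ k, p.coeff j * (ω ^ k * ζ) ^ j = p.coeff j * ζ ^ j * (ω ^ j) ^ k := fun k => by
        rw [mul_pow, ← pow_mul, ← pow_mul, mul_comm k j]; ring
      simp only [this]
      rw [← Finset.mul_sum, geom_sum_eq hne, ← pow_mul, mul_comm j m, pow_mul, hω.pow_eq_one]
      simp
    · intro h0
      exact absurd (Finset.mem_range.mpr (Nat.pos_of_ne_zero hm)) h0
  have hbound : ‖∑ k ∈ Finset.range m, p.eval (ω ^ k * ζ)‖ ≤ m * K := by
    refine (norm_sum_le_of_le _ fun k _ => hp (ω ^ k * ζ) ?_).trans_eq (by simp)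
    rw [norm_mul, norm_pow, hω.norm'_eq_one hm, hζ, Complex.norm_exp_ofReal_mul_I]
    simp
  rw [hsum, norm_mul, Complex.norm_natCast, hζm, hθ] at hbound
  exact le_of_mul_le_mul_left hbound (by exact_mod_cast Nat.pos_of_ne_zero hm)

/-! ### The coefficient estimate -/

theorem corollary1 (n : ℕ) (P : Polynomial ℂ) (hdeg : P.degree = (n : WithBot ℕ))
    (ρ : ℝ) (hρ : 1 ≤ ρ) (hP : ∀ z : ℂ, ‖z‖ < ρ → P.eval z ≠ 0)
    (s : ℕ) (hs : 1 ≤ s) (hsn : s < n) :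
    ‖P.coeff n‖ + ‖P.coeff s‖ / (n.choose s : ℝ) ≤ circleSupNorm P / (1 + ρ ^ s) := by
  set M := circleSupNorm P with hM
  have hn : P.natDegree ≤ n := Polynomial.natDegree_le_iff_degree_le.mpr hdeg.le
  have hM0 : 0 < M := (norm_pos_iff.mpr (hP 0 (by simp; linarith))).trans_le
    (norm_eval_le_circleSupNorm P (by simp))
  have hchoose : 0 < (n.choose s : ℝ) := by exact_mod_cast Nat.choose_pos hsn.le
  have hρs : 0 < 1 + ρ ^ s := by positivity
  -- With `x` and `y` the two derivatives of order `s`, add `ρ ^ s ‖x‖ ≤ ‖y‖` and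
  -- `‖x‖ + ‖y‖ ≤ n.choose s * M`.
  have hball : ∀ z ∈ Metric.ball (0 : ℂ) 1,
      ‖(Polynomial.hasseDeriv s P).eval z‖ ≤ n.choose s * M / (1 + ρ ^ s) := by
    intro z hz
    rw [mem_ball_zero_iff] at hz
    have h1 := (Polynomial.mixedDeriv_zero_ne_zero_and_pow_mul_norm_le hn hsn.le hP
      (hz.trans_le hρ)).2
    have h2 := Polynomial.norm_mixedDeriv_add_le hn (by omega) hsn.le hM0
      (fun w hw => norm_eval_le_circleSupNorm P hw.le) hz
    rw [Polynomial.mixedDeriv_self hn] at h1 h2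
    rw [le_div_iff₀ hρs]
    linarith
  have hcircle : ∀ z : ℂ, ‖z‖ = 1 →
      ‖(Polynomial.hasseDeriv s P).eval z‖ ≤ n.choose s * M / (1 + ρ ^ s) := by
    intro z hz
    refine le_on_closure hball (Polynomial.continuous _).norm.continuousOn continuousOn_const ?_
    rw [closure_ball _ one_ne_zero]
    simp [hz]
  -- The extreme coefficients of the Hasse derivative are `P.coeff s` and
  -- `n.choose s * P.coeff n`; they are distinct coefficients since `s < n`.
  have hvisser := Polynomial.norm_coeff_zero_add_norm_coeff_le (m := n - s) (by omega)
    ((Polynomial.natDegree_hasseDeriv_le P s).trans (by omega)) hcircle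
  rw [Polynomial.hasseDeriv_coeff, Polynomial.hasseDeriv_coeff, Nat.sub_add_cancel hsn.le, zero_add,
    Nat.choose_self, Nat.cast_one, one_mul, norm_mul, Complex.norm_natCast] at hvisser
  have e1 : ‖P.coeff n‖ + ‖P.coeff s‖ / (n.choose s : ℝ)
      = (‖P.coeff s‖ + n.choose s * ‖P.coeff n‖) / n.choose s := by
    field_simp; ring
  rw [e1, div_le_iff₀ hchoose]
  refine hvisser.trans_eq ?_
  ring
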